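/- Let $q=3f+1$ be a power of a prime $p$, let $\chi$ be a multiplicative character of order $3$ of the finite field $\mathbb F_q$, extended by $\chi(0)=0$, and let $Q_q=(\chi(i-j))_{i,j\in\mathbb F_q}$ be the generalized cubic Paley core. Let $\gamma$ be a primitive element of $\mathbb F_q$, let $H_i=\{\gamma^{3a+i}: 0\le a\le f-1\}$ for $i=0,1,2$ be the cubic cyclotomic classes, let $\psi$ be a nontrivial additive character of $\mathbb F_q$ (for example $\psi(x)=e^{2\pi \mathrm{i}\operatorname{Tr}(x)/p}$, with $\operatorname{Tr}$ the trace to $\mathbb F_p$), and let $\eta_i=\sum_{x\in H_i}\psi(x)$ be the Gaussian periods. There is exactly one integer $c$ such that $c\equiv 1\pmod 3$, $4q=c^2+27d^2$ for some integer $d$, and, in the case $p\equiv 1\pmod 3$, $p\nmid c$. For this $c$ and for every $\alpha\in\mathbb C$ with $\alpha^3=1$, $$|\det(Q_q+\alpha I_q)|=\Bigl(\prod_{i=0}^{2}(q+2+3\eta_i)\Bigr)^{f/2}=\bigl[(q+2)^3-3(q+2)^2-3(q-1)(q+2)+(3+c)q-1\bigr]^{(q-1)/6},$$ where the product and the expression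 in square brackets are positive real numbers, and the powers are positive real powers. -/

import Mathlib

/-- The generalized Paley core of a multiplicative character `χ` of the finite field `F`
(Mathlib's multiplicative characters vanish at the non-units, so `χ 0 = 0`):
the matrix indexed by the elements of `F` with entries `χ (i - j)`. -/
noncomputable def generalizedPaleyCore {F : Type*} [Field F] (χ : MulChar F ℂ) : Matrix F F ℂ :=
  Matrix.of fun i j => χ (i - j)

/-- The cyclotomic class `H_i = {γ ^ (ℓ a + i) : 0 ≤ a ≤ f - 1}`, for a field with
`ℓ f + 1` elements and a primitive element `γ`. -/
def cyclotomicClass {F : Type*} [Field F] [DecidableEq F] (γ : Fˣ) (l f i : ℕ) : Finset F :=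
  (Finset.range f).image fun a => ((γ ^ (l * a + i) : Fˣ) : F)

/-- The Gaussian period `η_i = ∑_{x ∈ H_i} ψ(x)`, for an additive character `ψ` of `F`;
the usual choice is `ψ(x) = exp (2 π I Tr(x) / p)`. -/
noncomputable def gaussianPeriod {F : Type*} [Field F] [DecidableEq F]
    (ψ : AddChar F ℂ) (γ : Fˣ) (l f i : ℕ) : ℂ :=
  ∑ x ∈ cyclotomicClass γ l f i, ψ x

/-- The conditions on the integer `c` of cubic cyclotomy, for a power `q` of the prime `p`:
`c ≡ 1 (mod 3)` and `4 q = c ^ 2 + 27 d ^ 2` for some integer `d`, and this representation is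
proper (`p ∤ c`) when `p ≡ 1 (mod 3)`. -/
def IsCubicCyclotomyParameter (p q : ℕ) (c : ℤ) : Prop :=
  c ≡ 1 [ZMOD 3] ∧ (∃ d : ℤ, 4 * (q : ℤ) = c ^ 2 + 27 * d ^ 2) ∧
    (p ≡ 1 [MOD 3] → ¬ (p : ℤ) ∣ c)

/-!
# The determinant of the cubic Paley core

The columns `(ψ (i * b))_i` of the additive character table are eigenvectors of the core
`(χ (i - j))`, with eigenvalues `χ⁻¹ b * G` for the Gauss sum `G = gaussSum χ ψ`
(`sum_mulChar_sub_mul_addChar`). Each of the three cubic classes contributes the same cube root of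
unity `f` times, so that `det (Q + α I) = α * (1 + G ^ 3) ^ f`
(`det_cubicPaleyCore_add_smul_one`).

Let `G'` be the Gauss sum of `χ⁻¹` and let `J`, `J'` be the Jacobi sums of `(χ, χ)` and
`(χ⁻¹, χ⁻¹)`. Then `J' = conj J`, `G * G' = q`, `G ^ 3 = q * J` and `G' ^ 3 = q * J'`, so
`1 + G ^ 3` and `1 + G' ^ 3` are conjugate, and their product is `B = q ^ 3 + c * q + 1` with `c = J + J'`.
Hence `‖det (Q + α I)‖ = B ^ (f / 2)`. The Gaussian periods are the inverse Fourier transform on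
the cubic classes of `-1`, `G`, `G'`, which factors `q + 2 + 3 * η_i` as
`(1 + ζ⁻ⁱ * G) * (1 + ζⁱ * G')`, and the product over `i` is again `B`
(`prod_card_add_two_add_three_mul_gaussianPeriod`).

It remains to see that the trace `c` of the Jacobi sum is the parameter of cubic cyclotomy, and that
this parameter is unique.
* The congruence `J ≡ -1` modulo `(ω - 1) ^ 2` and the norm `J * J' = q` give `c ≡ 1 [ZMOD 3]` and
  `4 * q = c ^ 2 + 27 * d ^ 2` (`exists_jacobiSum_add_jacobiSum_inv_eq`).
* The integer-valued function `χ + χ⁻¹` reduces modulo `p` to `y ↦ y ^ f + y ^ (2 * f)`. Summed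
  over `y = x * (1 - x)` this gives `c = ± (2 * f).choose f` in the field, which by Lucas's theorem is
  nonzero when `p ≡ 1 [MOD 3]` (`not_dvd_choose_two_mul`).
* For uniqueness, two proper representations are compared by Brahmagupta's identity when
  `p ≡ 1 [MOD 3]`; when `p ≡ 2 [MOD 3]`, inertness of `p` in the Eisenstein integers forces `d = 0`
  (`IsCubicCyclotomyParameter.eq`).
-/

/-! ### Integers represented by `c ^ 2 + 27 * d ^ 2` -/

/-- If `p` divides neither `c` nor `c'`, then composing the two representations (Brahmagupta's
identity) in the right order makes `q ∣ c * d' ± c' * d`, and the size of `27 * q ^ 2` forces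
this number to vanish. -/
theorem sq_eq_sq_of_four_mul_prime_pow_eq {p r : ℕ} (hp : p.Prime) (hr : r ≠ 0) (hp2 : p ≠ 2)
    {c d c' d' : ℤ} (h : 4 * (p : ℤ) ^ r = c ^ 2 + 27 * d ^ 2)
    (h' : 4 * (p : ℤ) ^ r = c' ^ 2 + 27 * d' ^ 2) (hc : ¬ (p : ℤ) ∣ c) (hc' : ¬ (p : ℤ) ∣ c') :
    c ^ 2 = c' ^ 2 := by
  have hpp : Prime (p : ℤ) := Nat.prime_iff_prime_int.mp hp
  set q : ℤ := (p : ℤ) ^ r with hq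
  have hq0 : 0 < q := pow_pos (by exact_mod_cast hp.pos) r
  have hpq : (p : ℤ) ∣ q := dvd_pow_self _ hr
  -- Size argument: a multiple of `q` whose square times `27` is at most `16 * q ^ 2` is zero.
  have key : ∀ x u : ℤ, q ∣ x → u ^ 2 + 27 * x ^ 2 = 16 * q ^ 2 → x = 0 := by
    rintro x u ⟨t, rfl⟩ hu
    by_contra h0
    have ht : t ≠ 0 := by rintro rfl; simp at h0
    have ht2 : 1 ≤ t ^ 2 := Order.one_le_iff_pos.mpr (by positivity)
    nlinarith [sq_nonneg u, mul_le_mul_of_nonneg_left ht2 (sq_nonneg q), pow_pos hq0 2]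
  have hprod : (c * d' - c' * d) * (c * d' + c' * d) = q * (4 * (d' ^ 2 - d ^ 2)) := by
    linear_combination (-d' ^ 2) * h + d ^ 2 * h'
  have hnot : ¬ ((p : ℤ) ∣ c * d' - c' * d ∧ (p : ℤ) ∣ c * d' + c' * d) := by
    rintro ⟨h1, h2⟩
    have h3 : (p : ℤ) ∣ 2 * (c * d') := by
      have := dvd_add h1 h2
      rwa [show c * d' - c' * d + (c * d' + c' * d) = 2 * (c * d') by ring] at this
    have h4 : ¬ (p : ℤ) ∣ 2 := by
      intro h4
      exact hp2 ((Nat.prime_dvd_prime_iff_eq hp Nat.prime_two).mp (by exact_mod_cast h4))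
    have h5 : (p : ℤ) ∣ d' :=
      (hpp.dvd_or_dvd ((hpp.dvd_or_dvd h3).resolve_left h4)).resolve_left hc
    apply hc'
    apply hpp.dvd_of_dvd_pow (n := 2)
    rw [show c' ^ 2 = 4 * q - 27 * d' ^ 2 by linarith]
    exact dvd_sub (hpq.mul_left _) ((dvd_pow h5 two_ne_zero).mul_left _)
  have hcop : ∀ x : ℤ, ¬ (p : ℤ) ∣ x → IsCoprime q x := fun x hx =>
    ((Prime.coprime_iff_not_dvd hpp).mpr hx).pow_left
  have hz : (c * d') ^ 2 = (c' * d) ^ 2 := by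
    by_cases h1 : (p : ℤ) ∣ c * d' - c' * d
    · have h2 : ¬ (p : ℤ) ∣ c * d' + c' * d := fun h2 => hnot ⟨h1, h2⟩
      have h3 : q ∣ c * d' - c' * d := (hcop _ h2).dvd_of_dvd_mul_right ⟨_, hprod⟩
      have := key _ (c * c' + 27 * (d * d')) h3
        (by linear_combination (-(4 * q)) * h - (c ^ 2 + 27 * d ^ 2) * h')
      linear_combination (c * d' + c' * d) * this
    · have h3 : q ∣ c * d' + c' * d := (hcop _ h1).dvd_of_dvd_mul_left ⟨_, hprod⟩
      have := key _ (c * c' - 27 * (d * d')) h3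
        (by linear_combination (-(4 * q)) * h - (c ^ 2 + 27 * d ^ 2) * h')
      linear_combination (c * d' - c' * d) * this
  have : (4 * q) * (c ^ 2 - c' ^ 2) = 0 := by
    linear_combination 27 * hz + c ^ 2 * h' - c' ^ 2 * h
  have := (mul_eq_zero.mp this).resolve_left (by positivity)
  linarith

/-- A prime `p ≡ 2 [MOD 3]` is inert in the Eisenstein integers. -/
theorem dvd_and_dvd_of_dvd_eisenstein_norm {p : ℕ} (hp : p.Prime) (hp3 : p % 3 = 2) {a b : ℤ}
    (h : (p : ℤ) ∣ a ^ 2 - a * b + b ^ 2) : (p : ℤ) ∣ a ∧ (p : ℤ) ∣ b := by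
  have : Fact p.Prime := ⟨hp⟩
  have h0 : (a : ZMod p) ^ 2 - a * b + b ^ 2 = 0 := by
    have := (ZMod.intCast_zmod_eq_zero_iff_dvd _ p).mpr h
    exact_mod_cast this
  rw [← ZMod.intCast_zmod_eq_zero_iff_dvd, ← ZMod.intCast_zmod_eq_zero_iff_dvd]
  have hb : (b : ZMod p) = 0 := by
    by_contra hb
    -- Otherwise `-a / b` is a primitive cube root of unity modulo `p`.
    set z : ZMod p := -(a / b) with hz
    have hab : (a : ZMod p) = -z * b := by rw [hz]; field_simp
    have h1 : z ^ 2 + z + 1 = 0 := by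
      rw [hab] at h0
      have : (b : ZMod p) ^ 2 * (z ^ 2 + z + 1) = 0 := by linear_combination h0
      exact (mul_eq_zero.mp this).resolve_left (pow_ne_zero 2 hb)
    have h3 : z ^ 3 = 1 := by linear_combination (z - 1) * h1
    have hz1 : z ≠ 1 := by
      intro hz1
      rw [hz1] at h1
      have h30 : ((3 : ℕ) : ZMod p) = 0 := by push_cast; linear_combination h1
      rw [ZMod.natCast_eq_zero_iff] at h30
      have := (Nat.prime_dvd_prime_iff_eq hp Nat.prime_three).mp h30
      omega
    have hz0 : z ≠ 0 := by rintro h; rw [h] at h3; simp at h3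
    have hord : orderOf z = 3 := orderOf_eq_prime h3 hz1
    have := ZMod.orderOf_dvd_card_sub_one hz0
    rw [hord] at this
    have := hp.two_le
    omega
  refine ⟨?_, hb⟩
  rw [hb] at h0
  simpa using h0

/-- As `p` is inert, only associates of powers of `p` have norm a power of `p`; the condition
`3 ∣ b` leaves only the rational integers among them. -/
theorem eq_zero_of_eisenstein_norm_eq_prime_pow {p : ℕ} (hp : p.Prime) (hp3 : p % 3 = 2) (r : ℕ)
    {a b : ℤ} (hb : 3 ∣ b) (h : a ^ 2 - a * b + b ^ 2 = (p : ℤ) ^ r) : b = 0 := by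
  induction r using Nat.strong_induction_on generalizing a b with
  | _ r ih =>
    rcases Nat.eq_zero_or_pos r with rfl | hr
    · obtain ⟨d, rfl⟩ := hb
      by_contra h0
      have hd : d ≠ 0 := by rintro rfl; simp at h0
      have : 1 ≤ d ^ 2 := Order.one_le_iff_pos.mpr (by positivity)
      nlinarith [sq_nonneg (2 * a - 3 * d)]
    · have hp0 : (p : ℤ) ≠ 0 := by exact_mod_cast hp.ne_zero
      obtain ⟨⟨a, rfl⟩, ⟨b, rfl⟩⟩ := dvd_and_dvd_of_dvd_eisenstein_norm hp hp3
        (h ▸ dvd_pow_self (p : ℤ) hr.ne')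
      have h2 : (p : ℤ) ^ 2 * (a ^ 2 - a * b + b ^ 2) = (p : ℤ) ^ r := by rw [← h]; ring
      have hr2 : 2 ≤ r := by
        have h3 : p ^ 2 ∣ p ^ r := by
          have : (p : ℤ) ^ 2 ∣ (p : ℤ) ^ r := ⟨_, h2.symm⟩
          exact_mod_cast this
        exact (Nat.pow_dvd_pow_iff_le_right hp.one_lt).mp h3
      have h4 : a ^ 2 - a * b + b ^ 2 = (p : ℤ) ^ (r - 2) := by
        apply mul_left_cancel₀ (pow_ne_zero 2 hp0)
        rw [h2, ← pow_add, Nat.add_sub_cancel' hr2]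
      have hb' : (3 : ℤ) ∣ b := by
        refine (Int.prime_three.dvd_or_dvd hb).resolve_left fun h => ?_
        have := (Nat.prime_dvd_prime_iff_eq Nat.prime_three hp).mp (by exact_mod_cast h)
        omega
      rw [ih (r - 2) (by omega) hb' h4, mul_zero]

/-- The representation `4 * p ^ r = c ^ 2 + 27 * d ^ 2` determines `c` once
`c ≡ 1 [ZMOD 3]` and, for `p ≡ 1 [MOD 3]`, it is proper. -/
theorem IsCubicCyclotomyParameter.eq {p r : ℕ} (hp : p.Prime) (hr : r ≠ 0) (hp3 : p ≠ 3)
    {c c' : ℤ} (h : IsCubicCyclotomyParameter p (p ^ r) c)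
    (h' : IsCubicCyclotomyParameter p (p ^ r) c') : c = c' := by
  obtain ⟨h1, ⟨d, hd⟩, h2⟩ := h
  obtain ⟨h1', ⟨d', hd'⟩, h2'⟩ := h'
  push_cast at hd hd'
  have hsq : c ^ 2 = c' ^ 2 := by
    have hmod : p % 3 ≠ 0 := fun h =>
      hp3 ((Nat.prime_dvd_prime_iff_eq Nat.prime_three hp).mp (Nat.dvd_of_mod_eq_zero h)).symm
    rcases (by omega : p % 3 = 1 ∨ p % 3 = 2) with h3 | h3
    · exact sq_eq_sq_of_four_mul_prime_pow_eq hp hr (by omega) hd hd' (h2 h3) (h2' h3)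
    · have aux : ∀ c d : ℤ, 4 * (p : ℤ) ^ r = c ^ 2 + 27 * d ^ 2 → c ^ 2 = 4 * (p : ℤ) ^ r := by
        intro c d hd
        -- `c` and `d` have the same parity, so `c = 2 * a - 3 * d`.
        have hpar : (2 : ℤ) ∣ c + 3 * d := by
          have h2 : Even (c ^ 2 + 27 * d ^ 2) := ⟨2 * (p : ℤ) ^ r, by rw [← hd]; ring⟩
          have h3 : Even (c + 3 * d) := by
            simpa [Int.even_add, Int.even_mul, Int.even_pow, show ¬ Even (27 : ℤ) by decide,
              show ¬ Even (3 : ℤ) by decide] using h2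
          exact h3.two_dvd
        obtain ⟨a, ha⟩ := hpar
        have hc : c = 2 * a - 3 * d := by linarith
        have := eq_zero_of_eisenstein_norm_eq_prime_pow hp h3 r (a := a) (b := 3 * d) ⟨d, rfl⟩
          (by rw [hc] at hd; linarith)
        have hd0 : d = 0 := by omega
        rw [hd, hd0]; ring
      rw [aux c d hd, aux c' d' hd']
  rcases sq_eq_sq_iff_eq_or_eq_neg.mp hsq with h | h
  · exact h
  · unfold Int.ModEq at h1 h1'
    omega

/-- By Lucas's theorem: all digits of `f = (p ^ r - 1) / 3` in base `p` equal `(p - 1) / 3`, so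
adding `f` to itself produces no carries. -/
theorem not_dvd_choose_two_mul {p : ℕ} (hp : p.Prime) (hp3 : p % 3 = 1) (r : ℕ) {f : ℕ}
    (hf : p ^ r = 3 * f + 1) : ¬ p ∣ (2 * f).choose f := by
  have : Fact p.Prime := ⟨hp⟩
  induction r generalizing f with
  | zero =>
    obtain rfl : f = 0 := by simpa using hf.symm
    simpa using hp.one_lt.ne'
  | succ r ih =>
    obtain ⟨m, hm⟩ : ∃ m, p = 3 * m + 1 := ⟨p / 3, by omega⟩
    have hmod : p ^ r % 3 = 1 := by simp [Nat.pow_mod, hp3]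
    obtain ⟨g, hg⟩ : ∃ g, p ^ r = 3 * g + 1 := ⟨p ^ r / 3, by omega⟩
    have hfg : f = m + p * g := by
      rw [pow_succ, hg] at hf
      have : 3 * f + 1 = 3 * (m + p * g) + 1 := by
        rw [← hf]; nlinarith
      omega
    have h2 : 2 * f = 2 * m + p * (2 * g) := by rw [hfg]; ring
    have hlucas := Choose.choose_modEq_choose_mod_mul_choose_div_nat (n := 2 * f) (k := f) (p := p)
    have hm1 : m < p := by omega
    have hm2 : 2 * m < p := by omega
    have e1 : 2 * f % p = 2 * m := by rw [h2, Nat.add_mul_mod_self_left, Nat.mod_eq_of_lt hm2]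
    have e2 : f % p = m := by rw [hfg, Nat.add_mul_mod_self_left, Nat.mod_eq_of_lt hm1]
    have e3 : 2 * f / p = 2 * g := by
      rw [h2, Nat.add_mul_div_left _ _ hp.pos, Nat.div_eq_of_lt hm2, zero_add]
    have e4 : f / p = g := by
      rw [hfg, Nat.add_mul_div_left _ _ hp.pos, Nat.div_eq_of_lt hm1, zero_add]
    rw [e1, e2, e3, e4] at hlucas
    rw [hlucas.dvd_iff dvd_rfl, hp.dvd_mul, not_or]
    refine ⟨fun h => ?_, ih hg⟩
    have h3 : p ∣ (2 * m).factorial :=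
      h.trans ⟨m.factorial * (2 * m - m).factorial, by
        rw [← mul_assoc]; exact (Nat.choose_mul_factorial_mul_factorial (by omega)).symm⟩
    have := hp.dvd_factorial.mp h3
    omega

/-! ### Sums and products over a finite field -/

theorem prod_eq_mul_prod_units {F M : Type*} [Field F] [Fintype F] [DecidableEq F] [CommMonoid M]
    (g : F → M) : ∏ x, g x = g 0 * ∏ u : Fˣ, g u := by
  rw [Fintype.prod_eq_mul_prod_subtype_ne g 0]
  congr 1
  exact (Fintype.prod_equiv unitsEquivNeZero _ _ fun _ => rfl).symm

theorem sum_eq_add_sum_units {F M : Type*} [Field F] [Fintype F] [DecidableEq F] [AddCommMonoid M]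
    (g : F → M) : ∑ x, g x = g 0 + ∑ u : Fˣ, g u :=
  prod_eq_mul_prod_units (M := Multiplicative M) g

theorem orderOf_eq_of_forall_mem_zpowers {F : Type*} [Field F] [Fintype F]
    {f : ℕ} (hF : Fintype.card F = 3 * f + 1) {γ : Fˣ} (hγ : ∀ x : Fˣ, x ∈ Subgroup.zpowers γ) :
    orderOf γ = 3 * f := by
  classical
  rw [orderOf_eq_card_of_forall_mem_zpowers hγ, Nat.card_eq_fintype_card, Fintype.card_units, hF,
    Nat.add_sub_cancel]

/-- Splitting a product over a field with `3 * f + 1` elements along the cubic classes. -/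
theorem prod_eq_mul_prod_range {F M : Type*} [Field F] [Fintype F] [DecidableEq F]
    [CommMonoid M] {f : ℕ} (hF : Fintype.card F = 3 * f + 1) {γ : Fˣ}
    (hγ : ∀ x : Fˣ, x ∈ Subgroup.zpowers γ) (g : F → M) :
    ∏ x, g x = g 0 * ∏ a ∈ Finset.range f, (g (γ ^ (3 * a) : Fˣ) * g (γ ^ (3 * a + 1) : Fˣ) *
      g (γ ^ (3 * a + 2) : Fˣ)) := by
  have hord := orderOf_eq_of_forall_mem_zpowers hF hγ
  have split : ∀ (n : ℕ) (h : ℕ → M), ∏ k ∈ Finset.range (3 * n), h k =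
      ∏ a ∈ Finset.range n, (h (3 * a) * h (3 * a + 1) * h (3 * a + 2)) := by
    intro n h
    induction n with
    | zero => simp
    | succ n ih =>
      rw [Finset.prod_range_succ, ← ih, show 3 * (n + 1) = 3 * n + 1 + 1 + 1 by ring,
        Finset.prod_range_succ, Finset.prod_range_succ, Finset.prod_range_succ]
      simp only [mul_assoc]
  rw [prod_eq_mul_prod_units, ← IsCyclic.image_range_orderOf hγ, Finset.prod_image, hord, split]
  exact fun i hi j hj h => pow_injOn_Iio_orderOf (by simpa using hi) (by simpa using hj) h

theorem sum_eq_add_sum_range {F M : Type*} [Field F] [Fintype F] [DecidableEq F]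
    [AddCommMonoid M] {f : ℕ} (hF : Fintype.card F = 3 * f + 1) {γ : Fˣ}
    (hγ : ∀ x : Fˣ, x ∈ Subgroup.zpowers γ) (g : F → M) :
    ∑ x, g x = g 0 + ∑ a ∈ Finset.range f, (g (γ ^ (3 * a) : Fˣ) + g (γ ^ (3 * a + 1) : Fˣ) +
      g (γ ^ (3 * a + 2) : Fˣ)) :=
  prod_eq_mul_prod_range (M := Multiplicative M) hF hγ g

theorem sum_pow_eq_ite {F : Type*} [Field F] [Fintype F] {i : ℕ} (hi : i ≠ 0) :
    ∑ x : F, x ^ i = if Fintype.card F - 1 ∣ i then -1 else 0 := by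
  classical
  rw [sum_eq_add_sum_units, zero_pow hi, zero_add, ← FiniteField.sum_pow_units F i]

theorem sum_mul_one_sub_pow {F : Type*} [Field F] [Fintype F] (n : ℕ) :
    ∑ x : F, (x * (1 - x)) ^ n =
      ∑ m ∈ Finset.range (n + 1), (-1) ^ m * (n.choose m : F) * ∑ x : F, x ^ (n + m) := by
  simp_rw [Finset.mul_sum]
  rw [Finset.sum_comm]
  refine Finset.sum_congr rfl fun x _ => ?_
  rw [mul_pow, show (1 : F) - x = -x + 1 by ring, add_pow, Finset.mul_sum]
  refine Finset.sum_congr rfl fun m _ => ?_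
  rw [neg_pow]
  ring

theorem sum_mul_one_sub_pow_eq_zero {F : Type*} [Field F] [Fintype F] {f : ℕ} (hf : f ≠ 0)
    (hF : Fintype.card F = 3 * f + 1) : ∑ x : F, (x * (1 - x)) ^ f = 0 := by
  rw [sum_mul_one_sub_pow]
  refine Finset.sum_eq_zero fun m hm => ?_
  rw [FiniteField.sum_pow_lt_card_sub_one, mul_zero]
  have := Finset.mem_range.mp hm
  omega

theorem sum_mul_one_sub_pow_two_mul {F : Type*} [Field F] [Fintype F] {f : ℕ} (hf : f ≠ 0)
    (hF : Fintype.card F = 3 * f + 1) :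
    ∑ x : F, (x * (1 - x)) ^ (2 * f) = (-1) ^ (f + 1) * ((2 * f).choose f : F) := by
  rw [sum_mul_one_sub_pow, Finset.sum_eq_single f]
  · rw [sum_pow_eq_ite (by omega), if_pos ⟨1, by omega⟩]
    ring
  · intro m hm hmf
    have := Finset.mem_range.mp hm
    rw [sum_pow_eq_ite (by omega), if_neg, mul_zero]
    rintro ⟨k, hk⟩
    rw [hF, Nat.add_sub_cancel] at hk
    -- `2 * f ≤ 3 * f * k ≤ 4 * f` leaves only `k = 1`.
    have hk1 : k = 1 := by
      rcases k with _ | _ | k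
      · omega
      · rfl
      · nlinarith [Nat.pos_of_ne_zero hf]
    subst hk1
    omega
  · intro h
    exact absurd (Finset.mem_range.mpr (by omega)) h

/-! ### Cubic characters -/

theorem add_sq_eq_neg_one_of_pow_three_eq_one {R : Type*} [CommRing R] [IsDomain R] {z : R}
    (hz : z ^ 3 = 1) (hz1 : z ≠ 1) : z + z ^ 2 = -1 := by
  have h : (z - 1) * (z ^ 2 + z + 1) = 0 := by linear_combination hz
  linear_combination (mul_eq_zero.mp h).resolve_left (sub_ne_zero.mpr hz1)

theorem mul_mul_add_eq_pow_three_add_pow_three {R : Type*} [CommRing R] {ζ : R}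
    (h2 : ζ + ζ ^ 2 = -1) (h3 : ζ ^ 3 = 1) (a x : R) :
    (a + x) * (a + ζ * x) * (a + ζ ^ 2 * x) = a ^ 3 + x ^ 3 := by
  linear_combination (a ^ 2 * x + a * x ^ 2 * ζ) * h2 + x ^ 3 * h3

section CubicCharacter

variable {F : Type*} [Field F] {χ : MulChar F ℂ}

theorem MulChar.sq_eq_inv_of_orderOf_eq_three (hχ : orderOf χ = 3) : χ ^ 2 = χ⁻¹ := by
  have h := pow_orderOf_eq_one χ
  rw [hχ] at h
  rw [eq_inv_iff_mul_eq_one, ← pow_succ, h]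

theorem MulChar.ne_one_of_orderOf_eq_three (hχ : orderOf χ = 3) : χ ≠ 1 := by
  rintro rfl
  simp at hχ

theorem MulChar.apply_neg_one_of_orderOf_eq_three (hχ : orderOf χ = 3) : χ (-1) = 1 := by
  have h : χ ^ 3 = 1 := hχ ▸ pow_orderOf_eq_one χ
  have h3 : χ (-1) ^ 3 = 1 := by
    rw [← MulChar.pow_apply' χ three_ne_zero, h]
    exact MulChar.one_apply isUnit_one.neg
  have h2 : χ (-1) ^ 2 = 1 := by rw [← map_pow, neg_one_sq, map_one]
  calc χ (-1) = χ (-1) ^ 3 := by rw [pow_succ, h2, one_mul]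
    _ = 1 := h3

theorem MulChar.apply_generator_pow (hχ : χ ^ 3 = 1) (γ : Fˣ) (a r : ℕ) :
    χ (γ ^ (3 * a + r) : Fˣ) = χ γ ^ r := by
  have h3 : χ γ ^ 3 = 1 := by
    rw [← MulChar.pow_apply' χ three_ne_zero, hχ, MulChar.one_apply_coe]
  rw [Units.val_pow_eq_pow_val, map_pow, pow_add, pow_mul, h3, one_pow, one_mul]

variable [Fintype F]

/-- A cubic character takes a primitive cube root of unity as its value at a generator. -/
theorem MulChar.isPrimitiveRoot_apply_generator (hχ : orderOf χ = 3) {γ : Fˣ}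
    (hγ : ∀ x : Fˣ, x ∈ Subgroup.zpowers γ) : IsPrimitiveRoot (χ γ) 3 := by
  have h : χ ^ 3 = 1 := hχ ▸ pow_orderOf_eq_one χ
  rw [IsPrimitiveRoot.iff_orderOf]
  apply orderOf_eq_prime
  · rw [← MulChar.pow_apply' χ three_ne_zero, h, MulChar.one_apply_coe]
  · intro h1
    apply MulChar.ne_one_of_orderOf_eq_three hχ
    rw [MulChar.eq_one_iff]
    intro a
    obtain ⟨k, rfl⟩ := mem_powers_iff_mem_zpowers.mpr (hγ a)
    simp [h1]

/-- `χ + χ⁻¹` and `y ↦ y ^ f + y ^ (2 * f)` take the same integral values (`0` at `0`, `2` at the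
nonzero cubes, `-1` elsewhere), the former in `ℂ` and the latter in `F`. -/
theorem MulChar.exists_int_eq_apply_add_inv {f : ℕ} (hf : f ≠ 0)
    (hF : Fintype.card F = 3 * f + 1) (hχ : orderOf χ = 3) (y : F) :
    ∃ t : ℤ, χ y + χ⁻¹ y = t ∧ y ^ f + y ^ (2 * f) = t := by
  classical
  rcases eq_or_ne y 0 with rfl | hy
  · exact ⟨0, by simp, by simp [hf]⟩
  obtain ⟨γ, hγ⟩ := IsCyclic.exists_generator (α := Fˣ)
  have hprim := MulChar.isPrimitiveRoot_apply_generator hχ hγ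
  have hord := orderOf_eq_of_forall_mem_zpowers hF hγ
  obtain ⟨k, hk⟩ := mem_powers_iff_mem_zpowers.mpr (hγ (Units.mk0 y hy))
  have hyk : y = ((γ ^ k : Fˣ) : F) := by rw [show γ ^ k = Units.mk0 y hy from hk]; rfl
  have hχy : χ y = χ γ ^ k := by simp [hyk]
  have h1 : χ y = 1 ↔ 3 ∣ k := by rw [hχy, hprim.pow_eq_one_iff_dvd]
  have h2 : y ^ f = 1 ↔ 3 ∣ k := by
    rw [hyk, ← Units.val_pow_eq_pow_val, Units.val_eq_one, ← pow_mul, ← orderOf_dvd_iff_pow_eq_one,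
      hord]
    exact Nat.mul_dvd_mul_iff_right (Nat.pos_of_ne_zero hf)
  have hχ3 : χ y ^ 3 = 1 := by rw [hχy, ← pow_mul, mul_comm, pow_mul, hprim.pow_eq_one, one_pow]
  have hy3 : (y ^ f) ^ 3 = 1 := by
    rw [← pow_mul, mul_comm, ← FiniteField.pow_card_sub_one_eq_one y hy, hF, Nat.add_sub_cancel]
  rw [← MulChar.sq_eq_inv_of_orderOf_eq_three hχ, MulChar.pow_apply' χ two_ne_zero,
    mul_comm 2 f, pow_mul]
  by_cases h : 3 ∣ k
  · exact ⟨2, by rw [h1.mpr h]; norm_num, by rw [h2.mpr h]; norm_num⟩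
  · exact ⟨-1, by rw [add_sq_eq_neg_one_of_pow_three_eq_one hχ3 (mt h1.mp h)]; norm_num,
      by rw [add_sq_eq_neg_one_of_pow_three_eq_one hy3 (mt h2.mp h)]; norm_num⟩

end CubicCharacter

/-! ### Cubic Gauss and Jacobi sums -/

section GaussJacobi

variable {F : Type*} [Field F] [Fintype F] {χ : MulChar F ℂ}

theorem gaussSum_mul_gaussSum_inv_of_orderOf_eq_three (hχ : orderOf χ = 3)
    {ψ : AddChar F ℂ} (hψ : ψ.IsPrimitive) :
    gaussSum χ ψ * gaussSum χ⁻¹ ψ = Fintype.card F := by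
  have h := mul_gaussSum_inv_eq_gaussSum χ⁻¹ ψ
  rw [MulChar.apply_neg_one_of_orderOf_eq_three (by rwa [orderOf_inv]), one_mul] at h
  rw [← h]
  exact gaussSum_mul_gaussSum_eq_card (MulChar.ne_one_of_orderOf_eq_three hχ) hψ

theorem gaussSum_pow_three_of_orderOf_eq_three (hχ : orderOf χ = 3)
    {ψ : AddChar F ℂ} (hψ : ψ.IsPrimitive) :
    gaussSum χ ψ ^ 3 = Fintype.card F * jacobiSum χ χ := by
  have h := gaussSum_pow_eq_prod_jacobiSum (by rw [hχ]; norm_num) hψ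
  rw [hχ, MulChar.apply_neg_one_of_orderOf_eq_three hχ] at h
  simpa using h

theorem star_jacobiSum_eq (χ φ : MulChar F ℂ) :
    star (jacobiSum χ φ) = jacobiSum χ⁻¹ φ⁻¹ := by
  simp [jacobiSum, MulChar.star_apply']

/-- The Jacobi sum of a cubic character is `A + B * ω` with `A ≡ -1` and `B ≡ 0` modulo `3`; its
norm is the cardinality of the field, and its trace is `2 * A - B`. -/
theorem exists_jacobiSum_add_jacobiSum_inv_eq (hχ : orderOf χ = 3)
    (h3 : 3 ∣ Fintype.card F - 1) :
    ∃ c d : ℤ, c ≡ 1 [ZMOD 3] ∧ jacobiSum χ χ + jacobiSum χ⁻¹ χ⁻¹ = c ∧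
      4 * (Fintype.card F : ℤ) = c ^ 2 + 27 * d ^ 2 := by
  have hχ3 : χ ^ 3 = 1 := hχ ▸ pow_orderOf_eq_one χ
  have hμ := Complex.isPrimitiveRoot_exp 3 (by norm_num)
  set μ := Complex.exp (2 * Real.pi * Complex.I / (3 : ℕ)) with hμdef
  have hμ3 : μ ^ 3 = 1 := hμ.pow_eq_one
  have hμ2 : μ + μ ^ 2 = -1 :=
    add_sq_eq_neg_one_of_pow_three_eq_one hμ3 (hμ.ne_one (by norm_num))
  have hconj : star μ = μ ^ 2 := by
    have h1 : μ * star μ = 1 := by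
      have := Complex.mul_conj' μ
      rw [Complex.norm_eq_one_of_pow_eq_one hμ3 (by norm_num)] at this
      simpa using this
    calc star μ = μ ^ 3 * star μ := by rw [hμ3, one_mul]
      _ = μ ^ 2 * (μ * star μ) := by ring
      _ = μ ^ 2 := by rw [h1, mul_one]
  obtain ⟨z, hz, hJ⟩ := exists_jacobiSum_eq_neg_one_add (by norm_num) hχ3 hχ3 h3 hμ
  have hz' : ∃ u v : ℤ, z = u + v * μ := by
    clear hJ
    induction hz using Algebra.adjoin_induction with
    | mem x hx => exact ⟨0, 1, by simpa using hx⟩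
    | algebraMap r => exact ⟨r, 0, by simp⟩
    | add x y _ _ hx hy =>
      obtain ⟨u, v, rfl⟩ := hx
      obtain ⟨u', v', rfl⟩ := hy
      exact ⟨u + u', v + v', by push_cast; ring⟩
    | mul x y _ _ hx hy =>
      obtain ⟨u, v, rfl⟩ := hx
      obtain ⟨u', v', rfl⟩ := hy
      exact ⟨u * u' - v * v', u * v' + v * u' - v * v', by
        push_cast; linear_combination (v * v' : ℂ) * hμ2⟩
  obtain ⟨u, v, rfl⟩ := hz'
  have hJ1 : jacobiSum χ χ = (3 * v - 1) + 3 * (v - u) * μ := by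
    rw [hJ]
    linear_combination (u - 3 * v + v * μ : ℂ) * hμ2
  have hJ2 : jacobiSum χ⁻¹ χ⁻¹ = (3 * v - 1) + 3 * (v - u) * μ ^ 2 := by
    rw [← star_jacobiSum_eq, hJ1]
    simp only [star_add, star_sub, star_mul', hconj, star_one, star_intCast, star_ofNat]
  refine ⟨3 * (u + v - 1) + 1, v - u, ?_, ?_, ?_⟩
  · unfold Int.ModEq
    omega
  · rw [hJ1, hJ2]
    push_cast
    linear_combination (3 * (v - u) : ℂ) * hμ2
  · have hnorm : jacobiSum χ χ * jacobiSum χ⁻¹ χ⁻¹ = Fintype.card F := by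
      have hne := MulChar.ne_one_of_orderOf_eq_three hχ
      refine jacobiSum_mul_jacobiSum_inv ?_ hne hne ?_
      · rw [ringChar.eq_zero]
        exact (CharP.ringChar_ne_zero_of_finite F).symm
      · rw [← pow_two, MulChar.sq_eq_inv_of_orderOf_eq_three hχ]
        exact inv_ne_one.mpr hne
    rw [hJ1, hJ2] at hnorm
    have : (4 * (Fintype.card F : ℤ) : ℂ) =
        ((3 * (u + v - 1) + 1 : ℤ) : ℂ) ^ 2 + 27 * ((v - u : ℤ) : ℂ) ^ 2 := by
      push_cast
      rw [← hnorm]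
      linear_combination (12 * (3 * v - 1) * (v - u) : ℂ) * hμ2 + (36 * (v - u) ^ 2 : ℂ) * hμ3
    exact_mod_cast this

/-- Reduced modulo `p`, the trace of the Jacobi sum becomes
`∑ x, ((x * (1 - x)) ^ f + (x * (1 - x)) ^ (2 * f))`, which is the central binomial coefficient
`(2 * f).choose f` up to sign. -/
theorem intCast_eq_choose_of_jacobiSum_add_jacobiSum_inv_eq {f : ℕ}
    (hF : Fintype.card F = 3 * f + 1) (hχ : orderOf χ = 3) {c : ℤ}
    (hc : jacobiSum χ χ + jacobiSum χ⁻¹ χ⁻¹ = c) :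
    (c : F) = (-1) ^ (f + 1) * ((2 * f).choose f : F) := by
  have hf : f ≠ 0 := by
    rintro rfl
    have := Fintype.one_lt_card (α := F)
    omega
  choose t ht1 ht2 using MulChar.exists_int_eq_apply_add_inv (χ := χ) hf hF hχ
  have hct : c = ∑ x : F, t (x * (1 - x)) := by
    have : (c : ℂ) = ((∑ x : F, t (x * (1 - x)) : ℤ) : ℂ) := by
      push_cast
      simp_rw [← ht1, ← hc, jacobiSum, Finset.sum_add_distrib, map_mul]
    exact_mod_cast this
  rw [hct, Int.cast_sum]
  simp_rw [← ht2, Finset.sum_add_distrib]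
  rw [sum_mul_one_sub_pow_eq_zero hf hF, sum_mul_one_sub_pow_two_mul hf hF, zero_add]

theorem isCubicCyclotomyParameter_jacobiSum_add_jacobiSum_inv (p : ℕ) [Fact p.Prime] [CharP F p]
    {f : ℕ} (hF : Fintype.card F = 3 * f + 1) (hχ : orderOf χ = 3) :
    ∃ c : ℤ, IsCubicCyclotomyParameter p (Fintype.card F) c ∧
      jacobiSum χ χ + jacobiSum χ⁻¹ χ⁻¹ = c := by
  obtain ⟨c, d, h1, hc, hd⟩ :=
    exists_jacobiSum_add_jacobiSum_inv_eq (χ := χ) hχ ⟨f, by omega⟩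
  refine ⟨c, ⟨h1, ⟨d, hd⟩, fun hp3 hpc => ?_⟩, hc⟩
  obtain ⟨n, hp, hn⟩ := FiniteField.card F p
  have h0 := intCast_eq_choose_of_jacobiSum_add_jacobiSum_inv_eq hF hχ hc
  rw [(CharP.intCast_eq_zero_iff F p c).mpr hpc] at h0
  have h2 : (((2 * f).choose f : ℕ) : F) = 0 := by
    simpa using h0.symm
  exact not_dvd_choose_two_mul hp hp3 n (hn ▸ hF) ((CharP.cast_eq_zero_iff F p _).mp h2)

end GaussJacobi

/-! ### Diagonalization of the Paley core -/

section Determinant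

variable {F : Type*} [Field F] [Fintype F]

theorem sum_mulChar_sub_mul_addChar {χ : MulChar F ℂ} (hχ1 : χ ≠ 1) (hχ : χ (-1) = 1)
    (ψ : AddChar F ℂ) (i b : F) :
    ∑ j, χ (i - j) * ψ (j * b) = ψ (i * b) * (χ⁻¹ b * gaussSum χ ψ) := by
  have h1 : ∑ j, χ (i - j) * ψ (j * b) = ψ (i * b) * gaussSum χ (ψ.mulShift (-b)) := by
    rw [← (Equiv.subLeft i).sum_comp, gaussSum, Finset.mul_sum]
    refine Finset.sum_congr rfl fun y _ => ?_
    rw [Equiv.subLeft_apply, sub_sub_cancel, AddChar.mulShift_apply,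
      show (i - y) * b = i * b + -b * y by ring, AddChar.map_add_eq_mul]
    ring
  rw [h1]
  congr 1
  rcases eq_or_ne b 0 with rfl | hb
  · rw [neg_zero, AddChar.mulShift_zero, gaussSum_one_right hχ1, MulChar.map_zero, zero_mul]
  · have h2 := gaussSum_mulShift_eq χ ψ (Units.mk0 (-b) (neg_ne_zero.mpr hb))
    rw [Units.val_mk0] at h2
    have h3 : χ⁻¹ (-1) = 1 := by rw [MulChar.inv_apply_eq_inv', hχ, inv_one]
    rw [h2, ← neg_one_mul, map_mul, h3, one_mul]

variable [DecidableEq F]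

theorem det_addChar_mul_ne_zero {ψ : AddChar F ℂ} (hψ : ψ.IsPrimitive) :
    (Matrix.of fun i b : F => ψ (i * b)).det ≠ 0 := by
  have h : (Matrix.of fun i b : F => ψ (i * b)) * (Matrix.of fun b j : F => ψ (-(b * j))) =
      (Fintype.card F : ℂ) • (1 : Matrix F F ℂ) := by
    ext i j
    have hs := AddChar.sum_mulShift (i - j) hψ
    simp only [Matrix.mul_apply, Matrix.of_apply, Matrix.smul_apply, Matrix.one_apply,
      smul_eq_mul, mul_ite, mul_one, mul_zero, ← AddChar.map_add_eq_mul]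
    calc ∑ b, ψ (i * b + -(b * j)) = ∑ b, ψ (b * (i - j)) :=
          Finset.sum_congr rfl fun b _ => by congr 1; ring
      _ = _ := by rw [hs]; simp [sub_eq_zero]
  intro h0
  have hdet := congrArg Matrix.det h
  rw [Matrix.det_mul, h0, zero_mul, Matrix.det_smul, Matrix.det_one, mul_one] at hdet
  exact pow_ne_zero _ (Nat.cast_ne_zero.mpr Fintype.card_ne_zero) hdet.symm

/-- The columns `(ψ (i * b))_i` of the character table are eigenvectors of the core. -/
theorem det_generalizedPaleyCore_add_smul_one_eq_prod {χ : MulChar F ℂ} (hχ1 : χ ≠ 1)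
    (hχ : χ (-1) = 1) {ψ : AddChar F ℂ} (hψ : ψ.IsPrimitive) (α : ℂ) :
    (generalizedPaleyCore χ + α • (1 : Matrix F F ℂ)).det =
      ∏ b, (α + χ⁻¹ b * gaussSum χ ψ) := by
  set V : Matrix F F ℂ := Matrix.of fun i b : F => ψ (i * b) with hV
  have h : (generalizedPaleyCore χ + α • (1 : Matrix F F ℂ)) * V =
      V * Matrix.diagonal fun b => α + χ⁻¹ b * gaussSum χ ψ := by
    rw [add_mul, Matrix.smul_mul, one_mul]
    ext i b
    rw [Matrix.add_apply, Matrix.mul_apply, Matrix.mul_diagonal, Matrix.smul_apply]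
    simp only [generalizedPaleyCore, hV, Matrix.of_apply, smul_eq_mul]
    rw [sum_mulChar_sub_mul_addChar hχ1 hχ]
    ring
  have hdet := congrArg Matrix.det h
  rw [Matrix.det_mul, Matrix.det_mul, Matrix.det_diagonal, mul_comm] at hdet
  exact mul_left_cancel₀ (det_addChar_mul_ne_zero hψ) hdet

end Determinant

section CubicPaley

variable {F : Type*} [Field F] [Fintype F] [DecidableEq F] {f : ℕ} {χ : MulChar F ℂ} {γ : Fˣ}

theorem det_cubicPaleyCore_add_smul_one (hF : Fintype.card F = 3 * f + 1) (hχ : orderOf χ = 3)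
    {ψ : AddChar F ℂ} (hψ : ψ.IsPrimitive) {α : ℂ} (hα : α ^ 3 = 1) :
    (generalizedPaleyCore χ + α • (1 : Matrix F F ℂ)).det = α * (1 + gaussSum χ ψ ^ 3) ^ f := by
  obtain ⟨γ, hγ⟩ := IsCyclic.exists_generator (α := Fˣ)
  have hχ' : orderOf χ⁻¹ = 3 := by rwa [orderOf_inv]
  have hχ3 : χ⁻¹ ^ 3 = 1 := hχ' ▸ pow_orderOf_eq_one χ⁻¹
  have hζ := MulChar.isPrimitiveRoot_apply_generator hχ' hγ
  have hζ2 := add_sq_eq_neg_one_of_pow_three_eq_one hζ.pow_eq_one (hζ.ne_one (by norm_num))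
  rw [det_generalizedPaleyCore_add_smul_one_eq_prod (MulChar.ne_one_of_orderOf_eq_three hχ)
    (MulChar.apply_neg_one_of_orderOf_eq_three hχ) hψ, prod_eq_mul_prod_range hF hγ,
    MulChar.map_zero, zero_mul, add_zero]
  congr 1
  rw [← Finset.card_range f, ← Finset.prod_const, Finset.card_range]
  refine Finset.prod_congr rfl fun a _ => ?_
  have h0 := MulChar.apply_generator_pow hχ3 γ a 0
  rw [add_zero, pow_zero] at h0
  rw [h0, MulChar.apply_generator_pow hχ3, MulChar.apply_generator_pow hχ3]
  rw [one_mul, ← hα, ← mul_mul_add_eq_pow_three_add_pow_three hζ2 hζ.pow_eq_one]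
  ring

/-! ### Gaussian periods -/

theorem gaussianPeriod_eq_sum_range (hF : Fintype.card F = 3 * f + 1)
    (hγ : ∀ x : Fˣ, x ∈ Subgroup.zpowers γ) (ψ : AddChar F ℂ) {i : ℕ} (hi : i < 3) :
    gaussianPeriod ψ γ 3 f i = ∑ a ∈ Finset.range f, ψ (γ ^ (3 * a + i) : Fˣ) := by
  have hord := orderOf_eq_of_forall_mem_zpowers hF hγ
  rw [gaussianPeriod, cyclotomicClass, Finset.sum_image]
  intro a ha b hb hab
  have ha' : a < f := by simpa using ha
  have hb' : b < f := by simpa using hb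
  have := pow_injOn_Iio_orderOf (x := γ) (Set.mem_Iio.mpr (by omega)) (Set.mem_Iio.mpr (by omega))
    (Units.ext hab)
  omega

theorem gaussSum_eq_gaussianPeriod (hF : Fintype.card F = 3 * f + 1)
    (hγ : ∀ x : Fˣ, x ∈ Subgroup.zpowers γ) (hχ : χ ^ 3 = 1) (ψ : AddChar F ℂ) :
    gaussSum χ ψ = gaussianPeriod ψ γ 3 f 0 + χ γ * gaussianPeriod ψ γ 3 f 1 +
      χ γ ^ 2 * gaussianPeriod ψ γ 3 f 2 := by
  rw [gaussSum, sum_eq_add_sum_range hF hγ, MulChar.map_zero, zero_mul, zero_add,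
    gaussianPeriod_eq_sum_range hF hγ ψ (by norm_num),
    gaussianPeriod_eq_sum_range hF hγ ψ (by norm_num),
    gaussianPeriod_eq_sum_range hF hγ ψ (by norm_num), Finset.mul_sum, Finset.mul_sum,
    ← Finset.sum_add_distrib, ← Finset.sum_add_distrib]
  refine Finset.sum_congr rfl fun a _ => ?_
  have h0 := MulChar.apply_generator_pow hχ γ a 0
  rw [add_zero, pow_zero] at h0
  rw [h0, MulChar.apply_generator_pow hχ, MulChar.apply_generator_pow hχ, add_zero, one_mul, pow_one]

theorem sum_gaussianPeriod (hF : Fintype.card F = 3 * f + 1)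
    (hγ : ∀ x : Fˣ, x ∈ Subgroup.zpowers γ) {ψ : AddChar F ℂ} (hψ : ψ ≠ 1) :
    gaussianPeriod ψ γ 3 f 0 + gaussianPeriod ψ γ 3 f 1 + gaussianPeriod ψ γ 3 f 2 = -1 := by
  have h := AddChar.sum_eq_zero_of_ne_one hψ
  rw [sum_eq_add_sum_range hF hγ, AddChar.map_zero_eq_one] at h
  rw [gaussianPeriod_eq_sum_range hF hγ ψ (by norm_num),
    gaussianPeriod_eq_sum_range hF hγ ψ (by norm_num),
    gaussianPeriod_eq_sum_range hF hγ ψ (by norm_num),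
    ← Finset.sum_add_distrib, ← Finset.sum_add_distrib]
  simp only [add_zero]
  linear_combination h

/-- Each factor `q + 2 + 3 * η_i` splits as `(1 + ζ⁻ⁱ * G) * (1 + ζⁱ * G')` for the Gauss sums
`G`, `G'` of `χ`, `χ⁻¹` and `ζ = χ γ`. -/
theorem prod_card_add_two_add_three_mul_gaussianPeriod (hF : Fintype.card F = 3 * f + 1)
    (hχ : orderOf χ = 3) (hγ : ∀ x : Fˣ, x ∈ Subgroup.zpowers γ) {ψ : AddChar F ℂ} (hψ : ψ ≠ 1) :
    ∏ i : Fin 3, ((Fintype.card F : ℂ) + 2 + 3 * gaussianPeriod ψ γ 3 f i) =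
      (1 + gaussSum χ ψ ^ 3) * (1 + gaussSum χ⁻¹ ψ ^ 3) := by
  have hχ' : orderOf χ⁻¹ = 3 := by rwa [orderOf_inv]
  have hζ := MulChar.isPrimitiveRoot_apply_generator hχ hγ
  have hζ3 := hζ.pow_eq_one
  have hζ2 := add_sq_eq_neg_one_of_pow_three_eq_one hζ3 (hζ.ne_one (by norm_num))
  have hG := gaussSum_eq_gaussianPeriod hF hγ (hχ ▸ pow_orderOf_eq_one χ) ψ
  have hG' := gaussSum_eq_gaussianPeriod hF hγ (hχ' ▸ pow_orderOf_eq_one χ⁻¹) ψ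
  rw [← MulChar.sq_eq_inv_of_orderOf_eq_three hχ, MulChar.pow_apply' χ two_ne_zero,
    MulChar.sq_eq_inv_of_orderOf_eq_three hχ] at hG'
  have hS := sum_gaussianPeriod hF hγ hψ
  have hq := gaussSum_mul_gaussSum_inv_of_orderOf_eq_three hχ (AddChar.IsPrimitive.of_ne_one hψ)
  rw [← hq]
  simp only [Fin.prod_univ_three, Fin.val_zero, Fin.val_one, Fin.val_two]
  set ζ := χ γ
  set S₀ := gaussianPeriod ψ γ 3 f 0
  set S₁ := gaussianPeriod ψ γ 3 f 1
  set S₂ := gaussianPeriod ψ γ 3 f 2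
  set G := gaussSum χ ψ
  set G' := gaussSum χ⁻¹ ψ
  have h0 : G * G' + 2 + 3 * S₀ = (1 + G) * (1 + G') := by
    linear_combination hS - hG - hG' - (S₁ + S₂ * (ζ ^ 2 - ζ + 1)) * hζ2
  have h1 : G * G' + 2 + 3 * S₁ = (1 + ζ ^ 2 * G) * (1 + ζ * G') := by
    linear_combination hS - ζ ^ 2 * hG - ζ * hG' - (S₀ + S₂ * ζ ^ 3) * hζ2 +
      (S₂ - 2 * S₁ - G * G') * hζ3
  have h2 : G * G' + 2 + 3 * S₂ = (1 + ζ * G) * (1 + ζ ^ 2 * G') := by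
    linear_combination hS - ζ * hG - ζ ^ 2 * hG' - (S₀ + S₁ * (ζ ^ 2 - ζ + 1)) * hζ2 -
      (S₂ * (ζ ^ 3 + 2) + G * G') * hζ3
  rw [h0, h1, h2]
  rw [← one_pow 3, ← mul_mul_add_eq_pow_three_add_pow_three hζ2 hζ3 1 G,
    ← mul_mul_add_eq_pow_three_add_pow_three hζ2 hζ3 1 G']
  ring

end CubicPaley

/-! ### The determinant formula -/

theorem cubicPolynomial_pos {q c d : ℝ} (hq : 4 ≤ q) (h : 4 * q = c ^ 2 + 27 * d ^ 2) :
    0 < q ^ 3 + c * q + 1 := by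
  have hc : -q ≤ c := by
    refine (abs_le.mp (abs_le_of_sq_le_sq ?_ (by linarith))).1
    nlinarith [sq_nonneg d]
  nlinarith [mul_le_mul_of_nonneg_right hc (by linarith : 0 ≤ q), sq_nonneg q]

theorem mainTheorem4 {F : Type*} [Field F] [Fintype F] [DecidableEq F]
    (p : ℕ) [Fact p.Prime] [CharP F p]
    (q f : ℕ) (hq : Fintype.card F = q) (hf : q = 3 * f + 1)
    (χ : MulChar F ℂ) (hχ : orderOf χ = 3)
    (γ : Fˣ) (hγ : ∀ x : Fˣ, x ∈ Subgroup.zpowers γ)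
    (ψ : AddChar F ℂ) (hψ : ψ ≠ 1)
    (α : ℂ) (hα : α ^ 3 = 1) :
    (∃! c : ℤ, IsCubicCyclotomyParameter p q c) ∧
    ∀ c : ℤ, IsCubicCyclotomyParameter p q c →
      ∃ P B : ℝ, 0 < P ∧ 0 < B ∧
        (P : ℂ) = ∏ i : Fin 3, ((q : ℂ) + 2 + 3 * gaussianPeriod ψ γ 3 f i) ∧
        B = ((q : ℝ) + 2) ^ 3 - 3 * ((q : ℝ) + 2) ^ 2 - 3 * ((q : ℝ) - 1) * ((q : ℝ) + 2)
          + (3 + (c : ℝ)) * (q : ℝ) - 1 ∧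
        ‖(generalizedPaleyCore χ + α • (1 : Matrix F F ℂ)).det‖ = P ^ ((f : ℝ) / 2) ∧
        P ^ ((f : ℝ) / 2) = B ^ (((q : ℝ) - 1) / 6) := by
  subst hq
  have hprim : ψ.IsPrimitive := AddChar.IsPrimitive.of_ne_one hψ
  obtain ⟨c₀, hc₀, hJ⟩ := isCubicCyclotomyParameter_jacobiSum_add_jacobiSum_inv p hf hχ
  have huniq : ∀ c : ℤ, IsCubicCyclotomyParameter p (Fintype.card F) c → c = c₀ := by
    intro c hc
    obtain ⟨n, hp, hn⟩ := FiniteField.card F p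
    have hp3 : p ≠ 3 := by
      rintro rfl
      have : 3 ∣ Fintype.card F := hn ▸ dvd_pow_self 3 n.pos.ne'
      omega
    rw [hn] at hc hc₀
    exact IsCubicCyclotomyParameter.eq hp n.pos.ne' hp3 hc hc₀
  refine ⟨⟨c₀, hc₀, huniq⟩, fun c hc => ?_⟩
  obtain rfl := huniq c hc
  obtain ⟨-, ⟨d, hd⟩, -⟩ := hc
  have hq4 : 4 ≤ Fintype.card F := by
    have := Fintype.one_lt_card (α := F)
    omega
  set q := Fintype.card F with hq
  have hB : 0 < (q : ℝ) ^ 3 + c * q + 1 :=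
    cubicPolynomial_pos (d := d) (by exact_mod_cast hq4) (by exact_mod_cast hd)
  -- `1 + G ^ 3` and `1 + G' ^ 3` are complex conjugates with product `q ^ 3 + c * q + 1`.
  have hG := gaussSum_pow_three_of_orderOf_eq_three hχ hprim
  have hG' := gaussSum_pow_three_of_orderOf_eq_three (χ := χ⁻¹) (by rwa [orderOf_inv]) hprim
  have hGG := gaussSum_mul_gaussSum_inv_of_orderOf_eq_three hχ hprim
  have hmul : (1 + gaussSum χ ψ ^ 3) * (1 + gaussSum χ⁻¹ ψ ^ 3) =
      (((q : ℝ) ^ 3 + c * q + 1 : ℝ) : ℂ) := by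
    push_cast
    calc (1 + gaussSum χ ψ ^ 3) * (1 + gaussSum χ⁻¹ ψ ^ 3)
        = 1 + (gaussSum χ ψ ^ 3 + gaussSum χ⁻¹ ψ ^ 3) + (gaussSum χ ψ * gaussSum χ⁻¹ ψ) ^ 3 := by
          ring
      _ = (q : ℂ) ^ 3 + c * q + 1 := by
          rw [hGG, hG, hG', ← mul_add, hJ]
          ring
  have hstar : star (1 + gaussSum χ ψ ^ 3) = 1 + gaussSum χ⁻¹ ψ ^ 3 := by
    rw [hG, hG', star_add, star_one, star_mul', star_natCast, star_jacobiSum_eq]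
  have hnorm : ‖1 + gaussSum χ ψ ^ 3‖ ^ 2 = (q : ℝ) ^ 3 + c * q + 1 := by
    have h := Complex.mul_conj' (1 + gaussSum χ ψ ^ 3)
    rw [starRingEnd_apply, hstar, hmul] at h
    exact_mod_cast h.symm
  have hαn : ‖α‖ = 1 := Complex.norm_eq_one_of_pow_eq_one hα three_ne_zero
  refine ⟨(q : ℝ) ^ 3 + c * q + 1, (q : ℝ) ^ 3 + c * q + 1, hB, hB, ?_, by ring, ?_, ?_⟩
  · rw [← hmul, prod_card_add_two_add_three_mul_gaussianPeriod hf hχ hγ hψ]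
  · rw [det_cubicPaleyCore_add_smul_one hf hχ hprim hα, norm_mul, hαn, one_mul, norm_pow, ← hnorm,
      ← Real.rpow_natCast _ 2, ← Real.rpow_mul (norm_nonneg _), ← Real.rpow_natCast]
    congr 1
    push_cast
    ring
  · congr 1
    rw [hf]
    push_cast
    ring
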